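/- **Setting.** Consider a finite directed network with a finite family of directed paths, each joining an origin-destination (OD) pair. Let $A$ be the number of arcs, $N$ the number of paths, $\Delta\in\{0,1\}^{A\times N}$ the arc-path incidence matrix, $\Pi$ the OD-path incidence matrix and $q$ the vector of OD demands. Put $D=\{f\in\mathbb R^N_+:\Pi f=q\}$ and let $\mathcal N_D(f)=\{w: w^\top(g-f)\le 0\ \forall g\in D\}$ for $f\in D$, $\mathcal N_D(f)=\emptyset$ for $f\notin D$. Norms are Euclidean for vectors, and the induced operator norms for matrices; $\eta_\Delta=\|\Delta\|$, $\eta_{\Delta^\top}=\|\Delta^\top\|$. Let $\Xi\subset\mathbb R^k$ be compact, let $\mathscr P(\Xi)$ be the set of Borel probability measures on $\Xi$ with the weak topology, and let $$\mathsf d_K(\mu,\nu)=\sup\Big\{\Big|\int\varphi\,d\mu-\int\varphi\,d\nu\Big| : \varphi \text{ real-valued and } 1\text{-Lipschitz}\Big\}$$ be the Kantorovich metric. Let $T(v,\xi)\in\mathbb R^A$ be the vector of arc travel times for the arc flow $v\in\mathbb R^A$ and $\xi\in\Xi$, with $T(\cdot,\xi)$ continuously differentiable for every $\xi\in\Xi$,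 and let $C(f,\xi)=\Delta^\top T(\Delta f,\xi)$ be the vector of path travel times. Fix $t>0$, $\theta_0\in\mathbb R$, $\theta_1,\theta_2\ge 0$, $d\in\mathbb R^N$, and $\tau\in\mathbb R^N$ with $\tau_r$ equal to the longest acceptable travel time of the OD pair joined by the path $r$. Let $$\hat u_t(f,\xi)=\theta_0 d+\theta_1 C(f,\xi)+\theta_2\,h(C(f,\xi)-\tau,t),\qquad h(z,t)=\begin{cases} z,& z>t,\\ \tfrac1{4t}(z^2+2zt+t^2),&-t\le z\le t,\\ 0,& z<-t,\end{cases}$$ with $h(\cdot,t)$ applied componentwise. For $Q\in\mathscr P(\Xi)$ put $\hat\phi_t(f,Q)=\mathbb E_Q[\hat u_t(f,\xi)]$ and let $\mathcal F_t(Q)$ be the set of all solutions $f$ of $0\in\hat\phi_t(f,Q)+\mathcal N_D(f)$ (the modified late arrival penalised user equilibria, MLAPUE). A solution $f^*\in\mathcal F_t(Q)$ is *strongly regular* if there are neighbourhoods $\mathcal V$ of $f^*$ and $\mathcal V_0$ of $0$ such that for every $\delta\in\mathcal V_0$ the linearized problem $\delta\in\hat\phi_t(f^*,Q)+\nabla_f\hat\phi_t(f^*,Q)(f-f^*)+\mathcal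 N_D(f)$ has exactly one solution $f$ in $\mathcal V$, and this solution is Lipschitz continuous in $\delta\in\mathcal V_0$. **Theorem 3.3 (Statistical robustness of the MLAPUE estimator).** Let $f_t:\mathscr P(\Xi)\to\mathbb R^N$ be continuous and such that, for every $Q\in\mathscr P(\Xi)$, $f_t(Q)\in\mathcal F_t(Q)$ and $f_t(Q)$ is strongly regular. Let $\mathbb F_t\subset\mathbb R^N$ be a convex compact set which, for some $b>0$, contains the open ball of radius $b$ around $f_t(Q)$ for every $Q\in\mathscr P(\Xi)$; put $\mathbb V_t=\Delta\,\mathbb F_t$. Assume that for some $L>0$, $$\|T(v,\xi)-T(v,\xi')\|\le L\|\xi-\xi'\|,\qquad \|\nabla_vT(v,\xi)-\nabla_vT(v,\xi')\|\le L\|\xi-\xi'\|\qquad\text{for all } v\in\mathbb V_t,\ \xi,\xi'\in\Xi.$$ Put $C_0'=\sup_{f\in\mathbb F_t,\,\xi\in\Xi}\|\nabla_fC(f,\xi)\|$ and, for a sample $\xi^1,\dots,\xi^M\in\Xi$, let $\hat f_{M,t}(\xi^1,\dots,\xi^M)=f_t\big(\frac1M\sum_{i=1}^M\delta_{\xi^i}\big)$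 be the sample average approximation estimator. Then there is a constant $\tilde C>0$, independent of $L$, $M$, $P$ and $Q$, such that, with $$K=L\,\tilde C\,\eta_{\Delta^\top}\Big(\theta_1+\theta_2+\theta_1\eta_\Delta+\theta_2\eta_\Delta+\theta_2\frac{C_0'}{2t}\Big),$$ the solution mapping satisfies $\|f_t(Q_1)-f_t(Q_2)\|\le K\,\mathsf d_K(Q_1,Q_2)$ for all $Q_1,Q_2\in\mathscr P(\Xi)$, and, for every sample size $M\ge1$, the estimator $\hat f_{M,t}:\Xi^M\to\mathbb R^N$ is measurable and $$\mathsf d_K\big(P^{\otimes M}\circ\hat f_{M,t}^{-1},\,Q^{\otimes M}\circ\hat f_{M,t}^{-1}\big)\le K\,\mathsf d_K(P,Q)\qquad\text{for all }P,Q\in\mathscr P(\Xi).$$ -/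

import Mathlib

open MeasureTheory Topology
open scoped ENNReal NNReal Matrix

noncomputable section

namespace Traffic

/-! ### Networks -/

/-- The list of arcs `l` is a directed walk from the node `u` to the node `v`. -/
def IsWalk {V A : Type*} (tail head : A → V) : V → List A → V → Prop
  | u, [], v => u = v
  | u, a :: l, v => tail a = u ∧ IsWalk tail head (head a) l v

/-- A directed path from `u` to `v`: a directed walk that visits no node twice. -/
def IsPath {V A : Type*} (tail head : A → V) (u : V) (l : List A) (v : V) : Prop :=
  IsWalk tail head u l v ∧ (u :: l.map head).Nodup

/-- A directed network with node set `V`, arc set `A`, origin-destination (OD) pairs `W`, and a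
family of paths indexed by `R`; the path `r` connects the OD pair `od r`, so that
`R_k = {r | od r = k}`. -/
structure Network (V A W R : Type*) where
  tail : A → V
  head : A → V
  origin : W → V
  dest : W → V
  od : R → W
  arcs : R → List A
  isPath : ∀ r, IsPath tail head (origin (od r)) (arcs r) (dest (od r))

namespace Network

variable {V A W R : Type*} (G : Network V A W R)

open Classical in
/-- The arc-path incidence matrix `Δ`. -/
def arcPathMatrix : Matrix A R ℝ := Matrix.of fun a r => if a ∈ G.arcs r then 1 else 0

open Classical in
/-- The OD-path incidence matrix `Π`. -/
def odPathMatrix : Matrix W R ℝ := Matrix.of fun k r => if G.od r = k then 1 else 0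

variable [Fintype A] [Fintype R]

open Classical in
/-- `Δ` as a linear map between Euclidean spaces (path flows to arc flows). Its norm is
`η_Δ = ‖Δ‖`, the operator norm for the Euclidean norms. -/
def Delta : EuclideanSpace ℝ R →L[ℝ] EuclideanSpace ℝ A :=
  (Matrix.toEuclideanLin G.arcPathMatrix).toContinuousLinearMap

open Classical in
/-- The transpose `Δᵀ` as a linear map between Euclidean spaces. -/
def DeltaT : EuclideanSpace ℝ A →L[ℝ] EuclideanSpace ℝ R :=
  (Matrix.toEuclideanLin G.arcPathMatrixᵀ).toContinuousLinearMap

end Network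

/-! ### The disutility with smoothed lateness penalty -/

/-- The smoothed lateness penalty `h(z, t)`, for `t > 0`. -/
def penalty (z t : ℝ) : ℝ :=
  if t < z then z
  else if -t ≤ z then 1 / (4 * t) * (z ^ 2 + 2 * z * t + t ^ 2)
  else 0

/-- The data of the traffic model; `k` is the dimension of the random vector `ξ`. -/
structure Model (V A W R : Type*) (k : ℕ) where
  /-- the network -/
  net : Network V A W R
  /-- the demands `q` of the OD pairs -/
  demand : W → ℝ
  /-- weight of the flow-independent attributes -/
  θ₀ : ℝ
  /-- value of time -/
  θ₁ : ℝ
  /-- value of being one time unit late -/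
  θ₂ : ℝ
  /-- flow-independent path attributes -/
  d : R → ℝ
  /-- longest acceptable travel times of the OD pairs -/
  τ : W → ℝ
  /-- arc travel times `T(v, ξ)` -/
  T : EuclideanSpace ℝ A → EuclideanSpace ℝ (Fin k) → EuclideanSpace ℝ A

namespace Model

variable {V A W R : Type*} [Fintype A] [Fintype R] {k : ℕ} (m : Model V A W R k)

/-- The feasible path flows `D = {f ≥ 0 : Π f = q}`. -/
def feasible : Set (EuclideanSpace ℝ R) :=
  {f | (∀ r, 0 ≤ f r) ∧ m.net.odPathMatrix *ᵥ (fun r => f r) = m.demand}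

/-- Path travel times `C(f, ξ) = Δᵀ T(Δ f, ξ)`. -/
def pathTime (f : EuclideanSpace ℝ R) (ξ : EuclideanSpace ℝ (Fin k)) : EuclideanSpace ℝ R :=
  m.net.DeltaT (m.T (m.net.Delta f) ξ)

/-- The disutility `û(f, C(f, ξ), t) = θ₀ d + θ₁ C(f, ξ) + θ₂ h(C(f, ξ) - τ, t)`. -/
def disutility (t : ℝ) (f : EuclideanSpace ℝ R) (ξ : EuclideanSpace ℝ (Fin k)) :
    EuclideanSpace ℝ R :=
  WithLp.toLp 2 fun r => m.θ₀ * m.d r + m.θ₁ * m.pathTime f ξ r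
    + m.θ₂ * penalty (m.pathTime f ξ r - m.τ (m.net.od r)) t

/-- The expected disutility `φ̂_t(f, Q) = E_Q[û(f, C(f, ξ), t)]`. -/
def expDisutility (t : ℝ) {Ξ : Set (EuclideanSpace ℝ (Fin k))} (Q : ProbabilityMeasure Ξ)
    (f : EuclideanSpace ℝ R) : EuclideanSpace ℝ R :=
  ∫ ξ : Ξ, m.disutility t f ξ ∂(Q : Measure Ξ)

/-- `C₀' = sup_{f ∈ F, ξ ∈ Ξ} ‖∇_f C(f, ξ)‖`. -/
def supGradPathTime (F : Set (EuclideanSpace ℝ R)) (Ξ : Set (EuclideanSpace ℝ (Fin k))) : ℝ :=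
  ⨆ p : F × Ξ, ‖fderiv ℝ (fun f => m.pathTime f p.2) (p.1 : EuclideanSpace ℝ R)‖

end Model

/-! ### Generalized equations -/

/-- The normal cone to the convex set `D` at `f`; as usual it is empty if `f ∉ D`. -/
def normalCone {E : Type*} [NormedAddCommGroup E] [InnerProductSpace ℝ E] (D : Set E) (f : E) :
    Set E :=
  {w | f ∈ D ∧ ∀ g ∈ D, inner ℝ w (g - f) ≤ 0}

/-- The solutions `z` of the generalized equation `δ ∈ φ(z) + N(z)`. -/
def geSolutions {E : Type*} [AddCommGroup E] (φ : E → E) (N : E → Set E) (δ : E) : Set E :=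
  {z | ∃ w ∈ N z, δ = φ z + w}

/-- `z₀` is a strongly regular solution of `0 ∈ φ(z) + N(z)` (for `φ` continuously
differentiable near `z₀`): for `δ` near `0` the linearized generalized equation
`δ ∈ φ(z₀) + Dφ(z₀)(z - z₀) + N(z)` has exactly one solution `ζ(δ)` in a fixed neighbourhood
of `z₀`, and `ζ` is Lipschitz continuous. -/
def IsStronglyRegular {E : Type*} [NormedAddCommGroup E] [NormedSpace ℝ E]
    (φ : E → E) (N : E → Set E) (z₀ : E) : Prop :=
  z₀ ∈ geSolutions φ N 0 ∧
  ∃ VZ ∈ 𝓝 z₀, ∃ VW ∈ 𝓝 (0 : E), ∃ (ζ : E → E) (c : ℝ≥0),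
    (∀ δ ∈ VW,
      geSolutions (fun z => φ z₀ + fderiv ℝ φ z₀ (z - z₀)) N δ ∩ VZ = {ζ δ}) ∧
    LipschitzOnWith c ζ VW

/-- The set of modified late arrival penalised user equilibria (MLAPUE) under `Q`: the solutions
of `0 ∈ E_Q[û(f, C(f, ξ), t)] + N_D(f)`. -/
def mlapue {V A W R : Type*} [Fintype A] [Fintype R] {k : ℕ} (m : Model V A W R k) (t : ℝ)
    {Ξ : Set (EuclideanSpace ℝ (Fin k))} (Q : ProbabilityMeasure Ξ) :
    Set (EuclideanSpace ℝ R) :=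
  geSolutions (m.expDisutility t Q) (normalCone m.feasible) 0

/-! ### Kantorovich metric, empirical measures, law of an estimator -/

/-- The Kantorovich metric `sup {|∫ φ dμ - ∫ φ dν| : φ 1-Lipschitz}`, as an extended nonnegative
real, for measures with finite first moment. -/
def kantorovich {X : Type*} [PseudoMetricSpace X] [MeasurableSpace X] (μ ν : Measure X) :
    ℝ≥0∞ :=
  ⨆ (φ : X → ℝ) (_ : LipschitzWith 1 φ), ENNReal.ofReal |∫ x, φ x ∂μ - ∫ x, φ x ∂ν|

/-- The empirical distribution `(1 / M) ∑ δ_{x i}` of a sample of size `M ≥ 1`. -/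
def empirical {X : Type*} [MeasurableSpace X] {M : ℕ} [NeZero M] (x : Fin M → X) :
    ProbabilityMeasure X :=
  ⟨(M : ℝ≥0∞)⁻¹ • ∑ i, Measure.dirac (x i), ⟨by
    simp only [Measure.smul_apply, Measure.finsetSum_apply, measure_univ, Finset.sum_const,
      Finset.card_univ, Fintype.card_fin, smul_eq_mul, nsmul_eq_mul, mul_one]
    exact ENNReal.inv_mul_cancel (by simp [NeZero.ne M]) (ENNReal.natCast_ne_top M)⟩⟩

/-- The statistical estimator `f̂_M(ξ¹, …, ξᴹ) = f(P_M)`, with `P_M` the empirical distribution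
of the sample. -/
def estimator {X E : Type*} [MeasurableSpace X] (f : ProbabilityMeasure X → E)
    (M : ℕ) [NeZero M] (x : Fin M → X) : E :=
  f (empirical x)

/-- The law `P^{⊗M} ∘ f̂_M⁻¹` of the estimator for a sample of `M` independent draws from `P`. -/
def estimatorLaw {X E : Type*} [MeasurableSpace X] [MeasurableSpace E]
    (f : ProbabilityMeasure X → E) (M : ℕ) [NeZero M] (P : ProbabilityMeasure X) : Measure E :=
  (Measure.pi fun _ : Fin M => (P : Measure X)).map (estimator f M)

end Traffic

end

noncomputable section

namespace Traffic

open Set Filter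

/-! ### Kantorovich bounds for expectations on a compact space. -/

section Integration

variable {X : Type*} [MetricSpace X] [CompactSpace X] [MeasurableSpace X] [BorelSpace X]

/-! Fix `Q₀`. Every `f Q` near `f Q₀` solves the equation linearized at `Q₀`, with the residual `δ
Q` of the linearization on the right, so strong regularity gives `‖f Q₁ - f Q₂‖ ≤ c ‖δ Q₁ - δ Q₂‖`.
The difference of residuals is a small multiple of `‖f Q₁ - f Q₂‖`, which is absorbed on the left,
plus a change of expectation at a fixed flow, which Kantorovich duality bounds by `κ` times the
distance of `Q₁` and `Q₂`; here `κ` is a Lipschitz constant of the disutility in `ξ`. This is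
`exists_locally_lipschitz_of_isStronglyRegular`.

The distributions on a compact set form a compact space, so finitely many local constants suffice.
Mixtures join any two distributions by a path whose Kantorovich length is at most their distance, so
the local estimate becomes global with the same constant.

For the estimator, replacing one of `M` observations moves the empirical measure by at most `1/M`
times the displacement. Exchanging the sampling law one coordinate at a time adds up `M` such
contributions, and `M` cancels.

The disutility gives `κ = L ‖Δᵀ‖ (θ₁ + θ₂)`; the other terms of the stated constant are nonnegative.
-/

lemma integrable_of_continuous_compactSpace {G : Type*} [NormedAddCommGroup G] {g : X → G}
    (hg : Continuous g) (μ : Measure X) [IsFiniteMeasure μ] : Integrable g μ :=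
  hg.integrable_of_hasCompactSupport (HasCompactSupport.of_compactSpace g)

/-- The expectation of a continuous vector-valued function depends continuously on the
distribution. -/
lemma continuous_integral_probabilityMeasure {G : Type*} [NormedAddCommGroup G] [NormedSpace ℝ G]
    [FiniteDimensional ℝ G] {g : X → G} (hg : Continuous g) :
    Continuous fun μ : ProbabilityMeasure X => ∫ x, g x ∂(μ : Measure X) := by
  have : CompleteSpace G := FiniteDimensional.complete ℝ G
  -- Weak convergence is tested on real functions, hence the passage to coordinates.
  let e := (Module.finBasis ℝ G).equivFunL
  rw [← e.toHomeomorph.comp_continuous_iff]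
  refine continuous_pi fun i => ?_
  let l : G →L[ℝ] ℝ := (ContinuousLinearMap.proj i).comp (e : G →L[ℝ] (Fin _ → ℝ))
  have h : ∀ μ : ProbabilityMeasure X, l (∫ x, g x ∂(μ : Measure X))
      = ∫ x, l (g x) ∂(μ : Measure X) := fun μ =>
    (l.integral_comp_comm (integrable_of_continuous_compactSpace hg _)).symm
  change Continuous fun μ : ProbabilityMeasure X => l (∫ x, g x ∂(μ : Measure X))
  simp_rw [h]
  exact ProbabilityMeasure.continuous_integral_continuousMap
    (⟨fun x => l (g x), l.continuous.comp hg⟩ : C(X, ℝ))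

/-- The mean of a 1-Lipschitz function is within the diameter of its value at any fixed point.
Finiteness makes `toReal` faithful in the later estimates. -/
lemma kantorovich_ne_top (μ ν : Measure X) [IsProbabilityMeasure μ] [IsProbabilityMeasure ν] :
    kantorovich μ ν ≠ ∞ := by
  obtain ⟨x₀⟩ : Nonempty X := nonempty_of_isProbabilityMeasure μ
  have key : ∀ (ρ : Measure X) [IsProbabilityMeasure ρ] (φ : X → ℝ), LipschitzWith 1 φ →
      |∫ x, φ x ∂ρ - φ x₀| ≤ Metric.diam (univ : Set X) := by
    intro ρ _ φ hφ
    have h1 : ∫ x, φ x ∂ρ - φ x₀ = ∫ x, (φ x - φ x₀) ∂ρ := by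
      rw [integral_sub (integrable_of_continuous_compactSpace hφ.continuous ρ)
        (integrable_const _)]
      simp
    rw [h1, ← Real.norm_eq_abs]
    refine (norm_integral_le_of_norm_le_const (C := Metric.diam (univ : Set X))
      (ae_of_all _ fun x => ?_)).trans (by simp)
    have := hφ.dist_le_mul x x₀
    rw [← dist_eq_norm]
    simp only [NNReal.coe_one, one_mul] at this
    exact this.trans (Metric.dist_le_diam_of_mem isCompact_univ.isBounded trivial trivial)
  refine ne_top_of_le_ne_top (ENNReal.ofReal_ne_top (r := 2 * Metric.diam (univ : Set X)))
    (iSup₂_le fun φ hφ => ENNReal.ofReal_le_ofReal ?_)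
  have h1 := abs_le.1 (key μ φ hφ)
  have h2 := abs_le.1 (key ν φ hφ)
  rw [abs_le]
  constructor <;> linarith

lemma kantorovich_le_ofReal {Y : Type*} [PseudoMetricSpace Y] [MeasurableSpace Y] {μ ν : Measure Y}
    {c : ℝ} (h : ∀ φ : Y → ℝ, LipschitzWith 1 φ → |∫ x, φ x ∂μ - ∫ x, φ x ∂ν| ≤ c) :
    kantorovich μ ν ≤ ENNReal.ofReal c :=
  iSup₂_le fun φ hφ => ENNReal.ofReal_le_ofReal (h φ hφ)

variable (μ ν : Measure X) [IsProbabilityMeasure μ] [IsProbabilityMeasure ν]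

lemma abs_integral_sub_le_kantorovich {φ : X → ℝ} (hφ : LipschitzWith 1 φ) :
    |∫ x, φ x ∂μ - ∫ x, φ x ∂ν| ≤ (kantorovich μ ν).toReal := by
  rw [← ENNReal.ofReal_le_iff_le_toReal (kantorovich_ne_top μ ν)]
  exact le_iSup₂ (f := fun (φ : X → ℝ) (_ : LipschitzWith 1 φ) =>
    ENNReal.ofReal |∫ x, φ x ∂μ - ∫ x, φ x ∂ν|) φ hφ

lemma abs_integral_sub_le_mul_kantorovich {φ : X → ℝ} {c : ℝ} (hc : 0 ≤ c)
    (hφ : ∀ x y, |φ x - φ y| ≤ c * dist x y) :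
    |∫ x, φ x ∂μ - ∫ x, φ x ∂ν| ≤ c * (kantorovich μ ν).toReal := by
  -- As `c` may vanish, `φ` is normalized by `c + e`, and then `e → 0`.
  have key : ∀ e > 0, |∫ x, φ x ∂μ - ∫ x, φ x ∂ν| ≤ (c + e) * (kantorovich μ ν).toReal := by
    intro e he
    have hce : 0 < c + e := by linarith
    have hl : LipschitzWith 1 fun x => (c + e)⁻¹ * φ x := by
      refine LipschitzWith.of_dist_le_mul fun x y => ?_
      rw [Real.dist_eq, ← mul_sub, abs_mul, abs_of_pos (inv_pos.2 hce), inv_mul_le_iff₀ hce,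
        NNReal.coe_one, one_mul]
      exact (hφ x y).trans (by gcongr; linarith)
    have := abs_integral_sub_le_kantorovich μ ν hl
    rwa [integral_const_mul, integral_const_mul, ← mul_sub, abs_mul, abs_of_pos (inv_pos.2 hce),
      inv_mul_le_iff₀ hce] at this
  have hlim : Tendsto (fun e : ℝ => (c + e) * (kantorovich μ ν).toReal) (𝓝[>] 0)
      (𝓝 ((c + 0) * (kantorovich μ ν).toReal)) :=
    ((continuous_const.add continuous_id).mul continuous_const).continuousAt.tendsto.mono_left
      nhdsWithin_le_nhds
  rw [add_zero] at hlim
  exact ge_of_tendsto hlim (eventually_mem_nhdsWithin.mono key)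

/-- Testing the difference `w` of the integrals against itself reduces to the scalar case for `⟪w,
g⟫`, without a dimension factor. -/
lemma norm_integral_sub_le_mul_kantorovich {E : Type*} [NormedAddCommGroup E]
    [InnerProductSpace ℝ E] [CompleteSpace E] {g : X → E} {c : ℝ} (hc : 0 ≤ c)
    (hg : ∀ x y, ‖g x - g y‖ ≤ c * dist x y) :
    ‖∫ x, g x ∂μ - ∫ x, g x ∂ν‖ ≤ c * (kantorovich μ ν).toReal := by
  have hcont : Continuous g := (LipschitzWith.of_dist_le_mul (K := ⟨c, hc⟩) fun x y => by
    rw [dist_eq_norm]; exact hg x y).continuous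
  set w := ∫ x, g x ∂μ - ∫ x, g x ∂ν with hw
  rcases eq_or_ne w 0 with h0 | h0
  · rw [h0, norm_zero]; positivity
  have hpos : 0 < ‖w‖ := norm_pos_iff.2 h0
  have h1 : ‖w‖ * ‖w‖ = ∫ x, inner ℝ w (g x) ∂μ - ∫ x, inner ℝ w (g x) ∂ν := by
    rw [integral_inner (integrable_of_continuous_compactSpace hcont μ),
      integral_inner (integrable_of_continuous_compactSpace hcont ν), ← inner_sub_right, ← hw,
      real_inner_self_eq_norm_mul_norm]
  have h2 := abs_integral_sub_le_mul_kantorovich μ ν (φ := fun x => inner ℝ w (g x))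
    (c := ‖w‖ * c) (by positivity) fun x y => by
      rw [← inner_sub_right, mul_assoc]
      exact (abs_real_inner_le_norm _ _).trans (by gcongr; exact hg x y)
  rw [← h1, abs_of_nonneg (by positivity), mul_assoc] at h2
  exact le_of_mul_le_mul_left h2 hpos

end Integration

/-! ### Segments between distributions. -/

section Mixture

variable {X : Type*} [MeasurableSpace X]

/-- The mixture `(1 - s) P + s Q`. -/
def mixture (P Q : ProbabilityMeasure X) (s : unitInterval) : ProbabilityMeasure X :=
  ⟨ENNReal.ofReal (1 - s) • (P : Measure X) + ENNReal.ofReal s • (Q : Measure X), ⟨by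
    simp only [Measure.add_apply, Measure.smul_apply, measure_univ, smul_eq_mul, mul_one]
    rw [← ENNReal.ofReal_add (by linarith [s.2.2]) s.2.1]
    simp⟩⟩

lemma mixture_zero (P Q : ProbabilityMeasure X) : mixture P Q 0 = P :=
  Subtype.ext (by simp [mixture])

lemma mixture_one (P Q : ProbabilityMeasure X) : mixture P Q 1 = Q :=
  Subtype.ext (by simp [mixture])

lemma integral_mixture (P Q : ProbabilityMeasure X) (s : unitInterval) {φ : X → ℝ}
    (hP : Integrable φ (P : Measure X)) (hQ : Integrable φ (Q : Measure X)) :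
    ∫ x, φ x ∂(mixture P Q s : Measure X)
      = (1 - s) * ∫ x, φ x ∂(P : Measure X) + s * ∫ x, φ x ∂(Q : Measure X) := by
  change ∫ x, φ x ∂(ENNReal.ofReal (1 - s) • (P : Measure X) + ENNReal.ofReal s • (Q : Measure X))
    = _
  rw [integral_add_measure (hP.smul_measure ENNReal.ofReal_ne_top)
    (hQ.smul_measure ENNReal.ofReal_ne_top), integral_smul_measure, integral_smul_measure,
    ENNReal.toReal_ofReal (by linarith [s.2.2]), ENNReal.toReal_ofReal s.2.1]
  rfl

end Mixture

/-! ### From local to global Lipschitz estimates. -/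

section LocalToGlobal

variable {X : Type*} [MetricSpace X] [CompactSpace X] [MeasurableSpace X] [BorelSpace X]

lemma continuous_mixture (P Q : ProbabilityMeasure X) : Continuous (mixture P Q) := by
  rw [ProbabilityMeasure.continuous_iff_forall_continuousMap_continuous_integral]
  intro φ
  simp_rw [integral_mixture P Q _ (integrable_of_continuous_compactSpace φ.continuous _)
    (integrable_of_continuous_compactSpace φ.continuous _)]
  fun_prop

/-- Two points of the segment differ by the multiple `s - r` of the signed measure `Q - P`. -/
lemma kantorovich_mixture_le (P Q : ProbabilityMeasure X) (s r : unitInterval) :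
    (kantorovich (mixture P Q s : Measure X) (mixture P Q r : Measure X)).toReal
      ≤ |(s : ℝ) - r| * (kantorovich (P : Measure X) (Q : Measure X)).toReal := by
  refine ENNReal.toReal_le_of_le_ofReal (by positivity) (kantorovich_le_ofReal fun φ hφ => ?_)
  have hi := fun ρ : ProbabilityMeasure X =>
    integrable_of_continuous_compactSpace hφ.continuous (ρ : Measure X)
  rw [integral_mixture P Q _ (hi P) (hi Q), integral_mixture P Q _ (hi P) (hi Q)]
  refine le_trans (le_of_eq ?_) (mul_le_mul_of_nonneg_left
    (abs_integral_sub_le_kantorovich (P : Measure X) (Q : Measure X) hφ) (abs_nonneg _))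
  rw [← abs_mul, ← abs_neg]
  congr 1
  ring

/-- A locally `c`-Lipschitz map on an interval is `c`-Lipschitz. -/
lemma norm_sub_le_of_locally_le {E : Type*} [NormedAddCommGroup E] {g : ℝ → E} {c a b : ℝ}
    (hab : a ≤ b) (hg : ContinuousOn g (Icc a b))
    (hloc : ∀ s ∈ Ico a b, ∀ᶠ r in 𝓝[>] s, ‖g r - g s‖ ≤ c * (r - s)) :
    ‖g b - g a‖ ≤ c * (b - a) := by
  -- The right slopes of `‖g s - g a‖` are at most `c`, so it stays below `c * (s - a)`.
  refine image_le_of_liminf_slope_right_le_deriv_boundary (f := fun s => ‖g s - g a‖)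
    (B := fun s => c * (s - a)) (B' := fun _ => c) (a := a) (b := b)
    (hg.sub continuousOn_const).norm (by simp) (by fun_prop) (fun s _ => ?_) (fun s hs r hr => ?_)
    (right_mem_Icc.2 hab)
  · simpa using (((hasDerivAt_id s).sub_const a).const_mul c).hasDerivWithinAt
  · refine Eventually.frequently ?_
    filter_upwards [hloc s hs, self_mem_nhdsWithin] with z hz hsz
    have hpos : 0 < z - s := sub_pos.2 hsz
    rw [slope_def_field, div_lt_iff₀ hpos]
    have h1 : ‖g z - g a‖ ≤ ‖g z - g s‖ + ‖g s - g a‖ := by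
      simpa using norm_add_le (g z - g s) (g s - g a)
    nlinarith

/-- A continuous map on the distributions that is locally `c`-Lipschitz for the Kantorovich metric
is globally so. -/
lemma norm_sub_le_kantorovich_of_locally {E : Type*} [NormedAddCommGroup E]
    {f : ProbabilityMeasure X → E} (hf : Continuous f) {c : ℝ} (hc : 0 ≤ c)
    (hloc : ∀ Q, ∃ U ∈ 𝓝 Q, ∀ Q₁ ∈ U, ∀ Q₂ ∈ U,
      ‖f Q₁ - f Q₂‖ ≤ c * (kantorovich (Q₁ : Measure X) (Q₂ : Measure X)).toReal)
    (P Q : ProbabilityMeasure X) :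
    ‖f P - f Q‖ ≤ c * (kantorovich (P : Measure X) (Q : Measure X)).toReal := by
  -- Clamping the parameter to `[0, 1]` makes the segment a continuous curve on `ℝ`.
  let p : ℝ → ProbabilityMeasure X := fun s => mixture P Q (projIcc 0 1 zero_le_one s)
  have hp : Continuous p := (continuous_mixture P Q).comp continuous_projIcc
  have hp0 : p 0 = P := by simp only [p, projIcc_left]; exact mixture_zero P Q
  have hp1 : p 1 = Q := by simp only [p, projIcc_right]; exact mixture_one P Q
  set d := (kantorovich (P : Measure X) (Q : Measure X)).toReal
  have key := norm_sub_le_of_locally_le (g := fun s => f (p s)) (c := c * d) zero_le_one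
    (hf.comp hp).continuousOn (fun s _ => by
      obtain ⟨U, hU, h⟩ := hloc (p s)
      filter_upwards [nhdsWithin_le_nhds (hp.continuousAt hU), self_mem_nhdsWithin] with r hr hsr
      refine (h _ hr _ (mem_of_mem_nhds hU)).trans ?_
      rw [mul_assoc, mul_comm d]
      refine mul_le_mul_of_nonneg_left ((kantorovich_mixture_le P Q _ _).trans ?_) hc
      refine mul_le_mul_of_nonneg_right ?_ ENNReal.toReal_nonneg
      have h1 := (LipschitzWith.projIcc (zero_le_one (α := ℝ))).dist_le_mul r s
      rw [NNReal.coe_one, one_mul, Subtype.dist_eq, Real.dist_eq, Real.dist_eq,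
        abs_of_pos (a := r - s) (sub_pos.2 hsr)] at h1
      exact h1)
  rw [norm_sub_rev]
  simpa [hp0, hp1] using key

end LocalToGlobal

/-! ### Independent samples and empirical measures. -/

section Sampling

variable {X : Type*} [MetricSpace X] [CompactSpace X] [MeasurableSpace X] [BorelSpace X]

/-- Expectations of functions of independent samples: a function that is `c`-Lipschitz in each
of the `n` variables. -/
lemma abs_integral_pi_sub_le_kantorovich (P Q : Measure X) [IsProbabilityMeasure P]
    [IsProbabilityMeasure Q] {c : ℝ} (hc : 0 ≤ c) {n : ℕ} {ψ : (Fin n → X) → ℝ}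
    (hψ : Continuous ψ)
    (hlip : ∀ x i a, |ψ (Function.update x i a) - ψ x| ≤ c * dist a (x i)) :
    |∫ x, ψ x ∂(Measure.pi fun _ => P) - ∫ x, ψ x ∂(Measure.pi fun _ => Q)|
      ≤ n * (c * (kantorovich P Q).toReal) := by
  induction n with
  | zero =>
    have : (Measure.pi fun _ : Fin 0 => P) = Measure.pi fun _ : Fin 0 => Q := by
      congr 1; funext i; exact i.elim0
    simp [this]
  | succ n ih =>
    have hcons : Continuous fun z : X × (Fin n → X) => (Fin.cons z.1 z.2 : Fin (n + 1) → X) := by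
      refine continuous_pi fun i => ?_
      refine Fin.cases ?_ (fun j => ?_) i
      · simpa using continuous_fst
      · exact ((continuous_apply j).comp continuous_snd :
          Continuous ((fun y : Fin n → X => y j) ∘ (Prod.snd : X × (Fin n → X) → Fin n → X)))
    have hint : ∀ (μ : Measure X) [IsProbabilityMeasure μ],
        ∫ x, ψ x ∂(Measure.pi fun _ : Fin (n + 1) => μ)
          = ∫ a, ∫ y, ψ (Fin.cons a y) ∂(Measure.pi fun _ : Fin n => μ) ∂μ := by
      intro μ _
      rw [← integral_prod (fun z : X × (Fin n → X) => ψ (Fin.cons z.1 z.2))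
        (integrable_of_continuous_compactSpace (hψ.comp hcons) _),
        ← ((measurePreserving_piFinSuccAbove (fun _ : Fin (n + 1) => μ) 0).symm).integral_comp']
      simp [MeasurableEquiv.piFinSuccAbove_symm_apply, Fin.insertNthEquiv]
    -- Only the first observation remains after the other `n` are averaged out. Its law is exchanged
    -- first (`h1`), then that of the others by induction (`h2`).
    let g : (μ : Measure X) → X → ℝ :=
      fun μ a => ∫ y, ψ (Fin.cons a y) ∂(Measure.pi fun _ : Fin n => μ)
    have hy : ∀ a, Continuous fun y : Fin n → X => ψ (Fin.cons a y) := fun a =>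
      hψ.comp (hcons.comp (by fun_prop : Continuous fun y : Fin n → X => (a, y)))
    have hg1 : ∀ (μ : Measure X) [IsProbabilityMeasure μ] (a b : X),
        |g μ a - g μ b| ≤ c * dist a b := by
      intro μ _ a b
      rw [← integral_sub (integrable_of_continuous_compactSpace (hy a) _)
        (integrable_of_continuous_compactSpace (hy b) _), ← Real.norm_eq_abs]
      refine (norm_integral_le_of_norm_le_const (C := c * dist a b)
        (ae_of_all _ fun y => ?_)).trans (by simp)
      have := hlip (Fin.cons b y) 0 a
      rwa [Fin.update_cons_zero, Fin.cons_zero] at this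
    have hgc : ∀ (μ : Measure X) [IsProbabilityMeasure μ], Continuous (g μ) := fun μ _ =>
      (LipschitzWith.of_dist_le_mul (K := ⟨c, hc⟩) fun x y => by
        rw [Real.dist_eq]; exact hg1 μ x y).continuous
    have hg2 : ∀ a, |g P a - g Q a| ≤ n * (c * (kantorovich P Q).toReal) := fun a =>
      ih (hy a) fun y i b => by
        have := hlip (Fin.cons a y) i.succ b
        rwa [← Fin.cons_update, Fin.cons_succ] at this
    rw [hint P, hint Q]
    change |∫ a, g P a ∂P - ∫ a, g Q a ∂Q| ≤ _
    have h1 := abs_integral_sub_le_mul_kantorovich P Q hc (hg1 P)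
    have h2 : |∫ a, g P a ∂Q - ∫ a, g Q a ∂Q| ≤ n * (c * (kantorovich P Q).toReal) := by
      rw [← integral_sub (integrable_of_continuous_compactSpace (hgc P) _)
        (integrable_of_continuous_compactSpace (hgc Q) _), ← Real.norm_eq_abs]
      exact (norm_integral_le_of_norm_le_const (ae_of_all _ hg2)).trans (by simp)
    have h3 := abs_sub_le (∫ a, g P a ∂P) (∫ a, g P a ∂Q) (∫ a, g Q a ∂Q)
    push_cast
    linarith

lemma integral_empirical {M : ℕ} [NeZero M] (x : Fin M → X) {φ : X → ℝ} (hφ : Continuous φ) :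
    ∫ a, φ a ∂(empirical x : Measure X) = (M : ℝ)⁻¹ * ∑ i, φ (x i) := by
  change ∫ a, φ a ∂((M : ℝ≥0∞)⁻¹ • ∑ i, Measure.dirac (x i)) = _
  rw [integral_smul_measure, integral_finsetSum_measure
    fun i _ => integrable_of_continuous_compactSpace hφ _]
  simp

lemma continuous_empirical (M : ℕ) [NeZero M] : Continuous (empirical : (Fin M → X) → _) := by
  rw [ProbabilityMeasure.continuous_iff_forall_continuousMap_continuous_integral]
  intro φ
  simp_rw [integral_empirical _ φ.continuous]
  fun_prop

/-- Only one atom, of mass `1 / M`, is moved. -/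
lemma kantorovich_empirical_update_le {M : ℕ} [NeZero M] (x : Fin M → X) (i : Fin M) (a : X) :
    (kantorovich (empirical (Function.update x i a) : Measure X) (empirical x : Measure X)).toReal
      ≤ (M : ℝ)⁻¹ * dist a (x i) := by
  refine ENNReal.toReal_le_of_le_ofReal (by positivity) (kantorovich_le_ofReal fun φ hφ => ?_)
  rw [integral_empirical _ hφ.continuous, integral_empirical _ hφ.continuous, ← mul_sub, abs_mul,
    abs_of_nonneg (by positivity : (0 : ℝ) ≤ (M : ℝ)⁻¹), ← Finset.sum_sub_distrib,
    Finset.sum_eq_single i (fun j _ hj => by simp [hj]) (by simp), Function.update_self]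
  gcongr
  simpa [Real.dist_eq] using hφ.dist_le_mul a (x i)

/-- A Lipschitz functional of the distribution gives estimators whose laws satisfy the same
Lipschitz estimate. -/
lemma kantorovich_estimatorLaw_le {E : Type*} [NormedAddCommGroup E] [MeasurableSpace E]
    [BorelSpace E] [SecondCountableTopology E] {f : ProbabilityMeasure X → E} (hf : Continuous f)
    {c : ℝ} (hc : 0 ≤ c)
    (hlip : ∀ P Q : ProbabilityMeasure X,
      ‖f P - f Q‖ ≤ c * (kantorovich (P : Measure X) (Q : Measure X)).toReal)
    (M : ℕ) [NeZero M] (P Q : ProbabilityMeasure X) :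
    kantorovich (estimatorLaw f M P) (estimatorLaw f M Q)
      ≤ ENNReal.ofReal c * kantorovich (P : Measure X) (Q : Measure X) := by
  have hM : (M : ℝ) ≠ 0 := by exact_mod_cast NeZero.ne M
  have hcont : Continuous (estimator f M) := hf.comp (continuous_empirical M)
  rw [← ENNReal.ofReal_toReal (kantorovich_ne_top (P : Measure X) (Q : Measure X)),
    ← ENNReal.ofReal_mul hc]
  refine kantorovich_le_ofReal fun φ hφ => ?_
  have hmap : ∀ P : ProbabilityMeasure X, ∫ y, φ y ∂(estimatorLaw f M P)
      = ∫ x, φ (estimator f M x) ∂(Measure.pi fun _ : Fin M => (P : Measure X)) := fun P =>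
    integral_map hcont.measurable.aemeasurable hφ.continuous.aestronglyMeasurable
  rw [hmap, hmap]
  -- The sensitivity to each observation is `c / M`; summed over `M` observations it is `c`.
  have := abs_integral_pi_sub_le_kantorovich (P : Measure X) (Q : Measure X)
    (c := c * (M : ℝ)⁻¹) (by positivity) (ψ := fun x => φ (estimator f M x))
    (hφ.continuous.comp hcont) (fun x i a => by
      have h1 := hφ.dist_le_mul (estimator f M (Function.update x i a)) (estimator f M x)
      rw [Real.dist_eq, NNReal.coe_one, one_mul, dist_eq_norm] at h1
      refine h1.trans ((hlip _ _).trans ?_)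
      rw [mul_assoc]
      gcongr
      exact kantorovich_empirical_update_le x i a)
  refine this.trans (le_of_eq ?_)
  field_simp

end Sampling

/-! ### Lipschitz stability from strong regularity. -/

section StrongRegularity

variable {X : Type*} [MetricSpace X] [CompactSpace X] {E : Type*} [NormedAddCommGroup E]

/-- A map that is continuous near `z₀`, jointly with a parameter in a compact space, is close to
its value at `z₀` uniformly in the parameter. -/
lemma eventually_forall_norm_sub_le {G : Type*} [NormedAddCommGroup G] {w : E → X → G}
    {U : Set E} (hU : IsOpen U) (hw : ContinuousOn (fun p : E × X => w p.1 p.2) (U ×ˢ univ))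
    {z₀ : E} (hz₀ : z₀ ∈ U) {ε : ℝ} (hε : 0 < ε) :
    ∀ᶠ z in 𝓝 z₀, ∀ x, ‖w z x - w z₀ x‖ ≤ ε := by
  have hc : Continuous fun x => w z₀ x :=
    continuousOn_univ.1 (hw.comp (f := fun x : X => (z₀, x)) (by fun_prop)
      fun x _ => ⟨hz₀, trivial⟩)
  have h : ∀ x ∈ (univ : Set X), ∀ᶠ p : E × X in 𝓝 (z₀, x), ‖w p.1 p.2 - w z₀ p.2‖ ≤ ε := by
    intro x _
    have h1 : ContinuousAt (fun p : E × X => ‖w p.1 p.2 - w z₀ p.2‖) (z₀, x) :=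
      ((hw.continuousAt ((hU.prod isOpen_univ).mem_nhds ⟨hz₀, trivial⟩)).sub
        (hc.continuousAt.comp continuousAt_snd)).norm
    have h2 : ‖w z₀ x - w z₀ x‖ < ε := by simpa using hε
    exact (h1.eventually (gt_mem_nhds h2)).mono fun _ => le_of_lt
  simpa using isCompact_univ.eventually_forall_of_forall_eventually h

variable [InnerProductSpace ℝ E]

/-- Strict differentiability, uniformly in a parameter ranging over a compact space. -/
lemma eventually_forall_norm_sub_sub_le {u : E → X → E} {u' : E → X → E →L[ℝ] E}
    {U : Set E} (hU : IsOpen U) (hderiv : ∀ z ∈ U, ∀ x, HasFDerivAt (fun z => u z x) (u' z x) z)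
    (hu' : ContinuousOn (fun p : E × X => u' p.1 p.2) (U ×ˢ univ))
    {z₀ : E} (hz₀ : z₀ ∈ U) {ε : ℝ} (hε : 0 < ε) :
    ∀ᶠ p : E × E in 𝓝 (z₀, z₀), ∀ x,
      ‖u p.1 x - u p.2 x - u' z₀ x (p.1 - p.2)‖ ≤ ε * ‖p.1 - p.2‖ := by
  obtain ⟨r, hr, hball⟩ := Metric.eventually_nhds_iff_ball.1
    (Eventually.and (p := fun z => z ∈ U) (hU.mem_nhds hz₀)
      (eventually_forall_norm_sub_le hU hu' hz₀ hε))
  rw [nhds_prod_eq]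
  filter_upwards [prod_mem_prod (Metric.ball_mem_nhds z₀ hr) (Metric.ball_mem_nhds z₀ hr)]
    with p hp x
  -- Mean value inequality on a ball where the derivative stays within `ε` of `u' z₀ x` for all `x`.
  exact (convex_ball z₀ r).norm_image_sub_le_of_norm_hasFDerivWithin_le'
    (fun z hz => (hderiv z (hball z hz).1 x).hasFDerivWithinAt)
    (fun z hz => (hball z hz).2 x) hp.2 hp.1

variable [FiniteDimensional ℝ E] [MeasurableSpace X] [BorelSpace X]

/-- If a continuous selection of solutions of `0 ∈ E_Q[u(z, ξ)] + N(z)` is strongly regular at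
`Q₀`, then it is Lipschitz near `Q₀`, with a constant that is proportional to the Lipschitz
constant of `u(z, ·)`. -/
theorem exists_locally_lipschitz_of_isStronglyRegular {u : E → X → E} {u' : E → X → E →L[ℝ] E}
    {U : Set E} (hU : IsOpen U)
    (hu : ContinuousOn (fun p : E × X => u p.1 p.2) (U ×ˢ univ))
    (hderiv : ∀ z ∈ U, ∀ x, HasFDerivAt (fun z => u z x) (u' z x) z)
    (hu' : ContinuousOn (fun p : E × X => u' p.1 p.2) (U ×ˢ univ))
    {N : E → Set E} {f : ProbabilityMeasure X → E} (hf : Continuous f) (hfU : ∀ Q, f Q ∈ U)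
    (hsol : ∀ Q : ProbabilityMeasure X,
      f Q ∈ geSolutions (fun z => ∫ x, u z x ∂(Q : Measure X)) N 0)
    {Q₀ : ProbabilityMeasure X}
    (hreg : IsStronglyRegular (fun z => ∫ x, u z x ∂(Q₀ : Measure X)) N (f Q₀)) :
    ∃ C : ℝ, 0 ≤ C ∧ ∃ S ∈ 𝓝 Q₀, ∀ κ : ℝ, 0 ≤ κ →
      (∀ z ∈ U, ∀ x y, ‖u z x - u z y‖ ≤ κ * dist x y) →
      ∀ Q₁ ∈ S, ∀ Q₂ ∈ S, ‖f Q₁ - f Q₂‖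
        ≤ C * (κ * (kantorovich (Q₁ : Measure X) (Q₂ : Measure X)).toReal) := by
  have : CompleteSpace E := FiniteDimensional.complete ℝ E
  obtain ⟨-, VZ, hVZ, VW, hVW, ζ, c, hζ, hζlip⟩ := hreg
  set z₀ := f Q₀ with hz₀
  have hz₀U : z₀ ∈ U := hfU Q₀
  have huc : ∀ z ∈ U, Continuous (u z) := fun z hz =>
    continuousOn_univ.1 (hu.comp (f := fun x : X => (z, x)) (by fun_prop)
      fun x _ => ⟨hz, trivial⟩)
  have hui : ∀ z ∈ U, ∀ Q : ProbabilityMeasure X, Integrable (u z) (Q : Measure X) :=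
    fun z hz Q => integrable_of_continuous_compactSpace (huc z hz) _
  have hu'c : Continuous (u' z₀) :=
    continuousOn_univ.1 (hu'.comp (f := fun x : X => (z₀, x)) (by fun_prop)
      fun x _ => ⟨hz₀U, trivial⟩)
  have hu'i : ∀ Q : ProbabilityMeasure X, Integrable (u' z₀) (Q : Measure X) :=
    fun Q => integrable_of_continuous_compactSpace hu'c _
  let φ : ProbabilityMeasure X → E → E := fun Q z => ∫ x, u z x ∂(Q : Measure X)
  let A : ProbabilityMeasure X → E →L[ℝ] E := fun Q => ∫ x, u' z₀ x ∂(Q : Measure X)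
  have hA : Continuous A := continuous_integral_probabilityMeasure hu'c
  -- A bound uniform in `x` survives integration, hence is uniform in `Q`.
  have hφest : ∀ ε > 0, ∀ᶠ p : E × E in 𝓝 (z₀, z₀), ∀ Q,
      ‖φ Q p.1 - φ Q p.2 - A Q (p.1 - p.2)‖ ≤ ε * ‖p.1 - p.2‖ := by
    intro ε hε
    have hUU : ∀ᶠ p : E × E in 𝓝 (z₀, z₀), p.1 ∈ U ∧ p.2 ∈ U :=
      (hU.prod hU).mem_nhds (mk_mem_prod hz₀U hz₀U)
    filter_upwards [eventually_forall_norm_sub_sub_le hU hderiv hu' hz₀U hε, hUU] with p hp hpU Q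
    have h1 : φ Q p.1 - φ Q p.2 - A Q (p.1 - p.2)
        = ∫ x, (u p.1 x - u p.2 x - u' z₀ x (p.1 - p.2)) ∂(Q : Measure X) := by
      rw [integral_sub (f := fun x => u p.1 x - u p.2 x)
        ((hui _ hpU.1 Q).sub (hui _ hpU.2 Q)) ((hu'i Q).apply_continuousLinearMap _),
        integral_sub (hui _ hpU.1 Q) (hui _ hpU.2 Q), ContinuousLinearMap.integral_apply (hu'i Q)]
    rw [h1]
    exact (norm_integral_le_of_norm_le_const (ae_of_all _ hp)).trans (by simp)
  -- This identifies the `fderiv` in the definition of strong regularity with the expected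
  -- derivative.
  have hφderiv : HasFDerivAt (φ Q₀) (A Q₀) z₀ := by
    refine HasStrictFDerivAt.hasFDerivAt (.of_isLittleO ?_)
    exact Asymptotics.isLittleO_iff.2 fun ε hε => (hφest ε hε).mono fun p hp => hp Q₀
  have hφcont : Tendsto (fun Q => φ Q (f Q)) (𝓝 Q₀) (𝓝 (φ Q₀ z₀)) := by
    have h1 : Tendsto (fun Q => φ Q (f Q) - φ Q z₀) (𝓝 Q₀) (𝓝 0) := by
      refine Metric.nhds_basis_closedBall.tendsto_right_iff.2 fun ε hε => ?_
      filter_upwards [hf.continuousAt.eventually (eventually_forall_norm_sub_le hU hu hz₀U hε)]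
        with Q hQ
      rw [mem_closedBall_zero_iff, ← integral_sub (hui _ (hfU Q) Q) (hui _ hz₀U Q)]
      exact (norm_integral_le_of_norm_le_const (ae_of_all _ hQ)).trans (by simp)
    have h2 : Tendsto (fun Q => φ Q z₀) (𝓝 Q₀) (𝓝 (φ Q₀ z₀)) :=
      (continuous_integral_probabilityMeasure (huc z₀ hz₀U)).tendsto Q₀
    simpa using h1.add h2
  -- The right-hand side for which `f Q` solves the equation linearized at `Q₀`; uniqueness in `VZ`
  -- then forces `f Q = ζ (δ Q)`.
  let δ : ProbabilityMeasure X → E := fun Q => φ Q₀ z₀ + A Q₀ (f Q - z₀) - φ Q (f Q)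
  have hδ : Tendsto δ (𝓝 Q₀) (𝓝 0) := by
    have h1 : Tendsto (fun Q => φ Q₀ z₀ + A Q₀ (f Q - z₀)) (𝓝 Q₀)
        (𝓝 (φ Q₀ z₀ + A Q₀ (f Q₀ - z₀))) :=
      Continuous.tendsto (by fun_prop) Q₀
    have h2 := h1.sub hφcont
    rwa [← hz₀, sub_self, map_zero, add_zero, sub_self] at h2
  have hfζ : ∀ᶠ Q in 𝓝 Q₀, δ Q ∈ VW ∧ f Q = ζ (δ Q) := by
    filter_upwards [hδ hVW, hf.continuousAt hVZ] with Q hQW hQZ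
    refine ⟨hQW, ?_⟩
    have hmem : f Q ∈ geSolutions (fun z => φ Q₀ z₀ + fderiv ℝ (φ Q₀) z₀ (z - z₀)) N (δ Q)
        ∩ VZ := by
      obtain ⟨w, hw, hw0⟩ := hsol Q
      refine ⟨⟨w, hw, ?_⟩, hQZ⟩
      have hw' : φ Q (f Q) = -w := eq_neg_of_add_eq_zero_left hw0.symm
      simp only [hφderiv.fderiv, δ, hw', sub_neg_eq_add]
    exact (hζ (δ Q) hQW).subset hmem
  -- Two error terms of size `ε` cost at most half of `‖z₁ - z₂‖` after multiplication by `c`;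
  -- absorbing them yields the constant `2 * c`. The summand `1` covers `c = 0`.
  set ε : ℝ := 1 / (4 * (c + 1)) with hεdef
  have hε : 0 < ε := by positivity
  have hcε : c * ε ≤ 1 / 4 := by
    rw [hεdef, mul_one_div, div_le_iff₀ (by positivity)]
    linarith
  have hAev : ∀ᶠ Q in 𝓝 Q₀, ‖A Q - A Q₀‖ ≤ ε := by
    have := hA.continuousAt.eventually (Metric.closedBall_mem_nhds (A Q₀) hε)
    filter_upwards [this] with Q hQ
    rwa [← dist_eq_norm]
  obtain ⟨V, hV, hVest⟩ : ∃ V ∈ 𝓝 z₀, ∀ z₁ ∈ V, ∀ z₂ ∈ V, ∀ Q,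
      ‖φ Q z₁ - φ Q z₂ - A Q (z₁ - z₂)‖ ≤ ε * ‖z₁ - z₂‖ := by
    have := hφest ε hε
    rw [nhds_prod_eq] at this
    obtain ⟨V, hV, h⟩ := mem_prod_same_iff.1 this
    exact ⟨V, hV, fun z₁ h₁ z₂ h₂ => h (mk_mem_prod h₁ h₂)⟩
  -- Constant and neighbourhood are fixed before `κ`, so neither depends on it.
  refine ⟨2 * c, by positivity, _, (hfζ.and (hAev.and (hf.continuousAt hV))), ?_⟩
  rintro κ hκ hulip Q₁ ⟨⟨hW₁, hf₁⟩, hA₁, hV₁⟩ Q₂ ⟨⟨hW₂, hf₂⟩, -, hV₂⟩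
  set z₁ := f Q₁
  set z₂ := f Q₂
  have e1 : ‖z₁ - z₂‖ ≤ c * ‖δ Q₁ - δ Q₂‖ := by
    have := hζlip.dist_le_mul _ hW₁ _ hW₂
    rwa [← hf₁, ← hf₂, dist_eq_norm, dist_eq_norm] at this
  -- Linearization error under `Q₁`, drift of the derivative from `Q₀`, and change of measure at the
  -- fixed point `z₂`.
  have e2 : δ Q₁ - δ Q₂ = -(φ Q₁ z₁ - φ Q₁ z₂ - A Q₁ (z₁ - z₂)) - (A Q₁ - A Q₀) (z₁ - z₂)
      - (φ Q₁ z₂ - φ Q₂ z₂) := by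
    simp only [δ, map_sub, _root_.sub_apply]
    abel
  have e3 : ‖φ Q₁ z₂ - φ Q₂ z₂‖
      ≤ κ * (kantorovich (Q₁ : Measure X) (Q₂ : Measure X)).toReal :=
    norm_integral_sub_le_mul_kantorovich _ _ hκ (hulip z₂ (hfU Q₂))
  have e4 : ‖δ Q₁ - δ Q₂‖ ≤ ε * ‖z₁ - z₂‖ + ε * ‖z₁ - z₂‖
      + κ * (kantorovich (Q₁ : Measure X) (Q₂ : Measure X)).toReal := by
    rw [e2]
    refine (norm_sub_le _ _).trans (add_le_add ((norm_sub_le _ _).trans (add_le_add ?_ ?_)) e3)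
    · rw [norm_neg]
      exact hVest _ hV₁ _ hV₂ Q₁
    · exact ((A Q₁ - A Q₀).le_opNorm _).trans (by gcongr)
  set d := κ * (kantorovich (Q₁ : Measure X) (Q₂ : Measure X)).toReal
  have e5 : ‖z₁ - z₂‖ ≤ 2 * (c * ε) * ‖z₁ - z₂‖ + c * d :=
    (e1.trans (mul_le_mul_of_nonneg_left e4 c.2)).trans (le_of_eq (by ring))
  nlinarith [norm_nonneg (z₁ - z₂)]

/-- A continuous selection of strongly regular solutions of `0 ∈ E_Q[u(z, ξ)] + N(z)` over all
distributions on a compact space is Lipschitz for the Kantorovich metric, with a constant that is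
proportional to the Lipschitz constant of `u(z, ·)`. -/
theorem exists_lipschitz_of_isStronglyRegular {u : E → X → E} {u' : E → X → E →L[ℝ] E}
    {U : Set E} (hU : IsOpen U)
    (hu : ContinuousOn (fun p : E × X => u p.1 p.2) (U ×ˢ univ))
    (hderiv : ∀ z ∈ U, ∀ x, HasFDerivAt (fun z => u z x) (u' z x) z)
    (hu' : ContinuousOn (fun p : E × X => u' p.1 p.2) (U ×ˢ univ))
    {N : E → Set E} {f : ProbabilityMeasure X → E} (hf : Continuous f) (hfU : ∀ Q, f Q ∈ U)
    (hsol : ∀ Q : ProbabilityMeasure X,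
      f Q ∈ geSolutions (fun z => ∫ x, u z x ∂(Q : Measure X)) N 0)
    (hreg : ∀ Q : ProbabilityMeasure X,
      IsStronglyRegular (fun z => ∫ x, u z x ∂(Q : Measure X)) N (f Q)) :
    ∃ C : ℝ, 0 < C ∧ ∀ κ : ℝ, 0 ≤ κ →
      (∀ z ∈ U, ∀ x y, ‖u z x - u z y‖ ≤ κ * dist x y) →
      ∀ P Q : ProbabilityMeasure X, ‖f P - f Q‖
        ≤ C * κ * (kantorovich (P : Measure X) (Q : Measure X)).toReal := by
  choose c hc S hS h using fun Q =>
    exists_locally_lipschitz_of_isStronglyRegular hU hu hderiv hu' hf hfU hsol (hreg Q)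
  -- Compactness of the space of distributions; the sum over the finite cover dominates each local
  -- constant.
  obtain ⟨t, ht⟩ := CompactSpace.elim_nhds_subcover (fun Q => interior (S Q))
    fun Q => interior_mem_nhds.2 (hS Q)
  have hle : ∀ Q ∈ t, c Q ≤ 1 + ∑ Q ∈ t, c Q := fun Q hQ => by
    have := Finset.single_le_sum (fun Q _ => hc Q) hQ
    linarith
  have hpos : 0 < 1 + ∑ Q ∈ t, c Q := by
    have := Finset.sum_nonneg fun Q (_ : Q ∈ t) => hc Q
    linarith
  refine ⟨1 + ∑ Q ∈ t, c Q, hpos, fun κ hκ hlip P Q => ?_⟩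
  refine norm_sub_le_kantorovich_of_locally hf (by positivity) (fun Q₀ => ?_) P Q
  obtain ⟨Q', hQ', hQ₀⟩ : ∃ Q' ∈ t, Q₀ ∈ interior (S Q') := by
    simpa using ht.symm.subset (mem_univ Q₀)
  refine ⟨S Q', mem_interior_iff_mem_nhds.1 hQ₀, fun Q₁ h₁ Q₂ h₂ => ?_⟩
  refine (h Q' κ hκ hlip Q₁ h₁ Q₂ h₂).trans ?_
  rw [mul_assoc]
  exact mul_le_mul_of_nonneg_right (hle Q' hQ')
    (mul_nonneg hκ ENNReal.toReal_nonneg)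

end StrongRegularity

/-! ### The smoothed lateness penalty. -/

/-- The first-order remainder is at most `(y - x) ^ 2`, also across the kink. -/
lemma hasDerivAt_max_zero_sq (x : ℝ) : HasDerivAt (fun x : ℝ => max x 0 ^ 2) (2 * max x 0) x := by
  rw [hasDerivAt_iff_isLittleO]
  refine Asymptotics.IsBigO.trans_isLittleO (Asymptotics.IsBigO.of_bound 1
    (Eventually.of_forall fun y => ?_)) (Asymptotics.isLittleO_pow_sub_sub x one_lt_two)
  rw [one_mul, Real.norm_eq_abs, Real.norm_eq_abs, Real.norm_eq_abs,
    abs_of_nonneg (sq_nonneg |y - x|), sq_abs, smul_eq_mul, abs_le]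
  rcases le_total x 0 with hx | hx <;> rcases le_total y 0 with hy | hy <;>
    simp only [max_eq_left, max_eq_right, hx, hy] <;> constructor <;> nlinarith

/-- Squared positive parts replace the case distinction, so smoothness at `z = ±t` needs no gluing.
-/
lemma penalty_eq {t : ℝ} (ht : 0 < t) (z : ℝ) :
    penalty z t = (max (z + t) 0 ^ 2 - max (z - t) 0 ^ 2) / (4 * t) := by
  unfold penalty
  split_ifs with h1 h2
  · rw [max_eq_left (by linarith), max_eq_left (by linarith)]
    field_simp
    ring
  · rw [max_eq_left (by linarith), max_eq_right (by linarith)]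
    field_simp
    ring
  · rw [max_eq_right (by linarith), max_eq_right (by linarith)]
    simp

lemma hasDerivAt_penalty {t : ℝ} (ht : 0 < t) (z : ℝ) :
    HasDerivAt (fun z => penalty z t) ((max (z + t) 0 - max (z - t) 0) / (2 * t)) z := by
  simp_rw [penalty_eq ht]
  have h1 := ((hasDerivAt_max_zero_sq (z + t)).comp_add_const z t).sub
    ((hasDerivAt_max_zero_sq (z - t)).comp_sub_const z t)
  convert! h1.div_const (4 * t) using 1
  field_simp
  ring

lemma contDiff_penalty {t : ℝ} (ht : 0 < t) : ContDiff ℝ 1 fun z => penalty z t := by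
  rw [contDiff_one_iff_deriv]
  refine ⟨fun z => (hasDerivAt_penalty ht z).differentiableAt, ?_⟩
  rw [funext fun z => (hasDerivAt_penalty ht z).deriv]
  fun_prop

/-- The derivative compares positive parts at points `2 * t` apart and divides by `2 * t`, so it is
at most `1` in absolute value. -/
lemma abs_penalty_sub_le {t : ℝ} (ht : 0 < t) (x y : ℝ) :
    |penalty x t - penalty y t| ≤ |x - y| := by
  have h := convex_univ.norm_image_sub_le_of_norm_hasDerivWithin_le (C := 1)
    (fun z _ => (hasDerivAt_penalty ht z).hasDerivWithinAt) (fun z _ => ?_)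
    (mem_univ y) (mem_univ x)
  · simpa using h
  · rw [Real.norm_eq_abs, abs_le, le_div_iff₀ (by linarith), div_le_iff₀ (by linarith)]
    rcases le_total (z + t) 0 with h1 | h1 <;> rcases le_total (z - t) 0 with h2 | h2 <;>
      simp only [max_eq_left, max_eq_right, h1, h2] <;> constructor <;> linarith

lemma norm_le_mul_norm_of_forall_abs_le {R : Type*} [Fintype R] {v w : EuclideanSpace ℝ R} {c : ℝ}
    (hc : 0 ≤ c) (h : ∀ r, |v r| ≤ c * |w r|) : ‖v‖ ≤ c * ‖w‖ := by
  rw [← abs_of_nonneg hc, ← Real.norm_eq_abs, ← norm_smul, EuclideanSpace.norm_eq,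
    EuclideanSpace.norm_eq]
  refine Real.sqrt_le_sqrt (Finset.sum_le_sum fun r _ => ?_)
  refine pow_le_pow_left₀ (norm_nonneg _) ?_ 2
  rw [PiLp.smul_apply, norm_smul, Real.norm_eq_abs c, abs_of_nonneg hc]
  exact h r

/-! ### Regularity of the disutility. -/

namespace Model

variable {V A W R : Type*} [Fintype R] {k : ℕ} (m : Model V A W R k)

/-- The disutility as a function of the path travel times. -/
def disutilityOfTime (t : ℝ) (c : EuclideanSpace ℝ R) : EuclideanSpace ℝ R :=
  WithLp.toLp 2 fun r => m.θ₀ * m.d r + m.θ₁ * c r + m.θ₂ * penalty (c r - m.τ (m.net.od r)) t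

lemma contDiff_disutilityOfTime {t : ℝ} (ht : 0 < t) : ContDiff ℝ 1 (m.disutilityOfTime t) := by
  rw [contDiff_euclidean]
  intro r
  have h : ContDiff ℝ 1 fun c : EuclideanSpace ℝ R => c r := contDiff_euclidean.1 contDiff_id r
  exact (contDiff_const.add (contDiff_const.mul h)).add
    (contDiff_const.mul ((contDiff_penalty ht).comp (h.sub contDiff_const)))

lemma norm_disutilityOfTime_sub_le {t : ℝ} (ht : 0 < t) (hθ₁ : 0 ≤ m.θ₁) (hθ₂ : 0 ≤ m.θ₂)
    (c c' : EuclideanSpace ℝ R) :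
    ‖m.disutilityOfTime t c - m.disutilityOfTime t c'‖ ≤ (m.θ₁ + m.θ₂) * ‖c - c'‖ := by
  refine norm_le_mul_norm_of_forall_abs_le (by positivity) fun r => ?_
  have h1 := abs_penalty_sub_le ht (c r - m.τ (m.net.od r)) (c' r - m.τ (m.net.od r))
  rw [sub_sub_sub_cancel_right] at h1
  have h2 : (m.disutilityOfTime t c - m.disutilityOfTime t c') r = m.θ₁ * (c r - c' r)
      + m.θ₂ * (penalty (c r - m.τ (m.net.od r)) t - penalty (c' r - m.τ (m.net.od r)) t) := by
    simp only [disutilityOfTime, PiLp.sub_apply]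
    ring
  rw [h2, PiLp.sub_apply, add_mul]
  refine (abs_add_le _ _).trans (add_le_add ?_ ?_)
  · rw [abs_mul, abs_of_nonneg hθ₁]
  · rw [abs_mul, abs_of_nonneg hθ₂]
    gcongr

variable [Fintype A]

/-- The derivative of the disutility with respect to the path flow. -/
def disutilityDeriv (t : ℝ) (f : EuclideanSpace ℝ R) (ξ : EuclideanSpace ℝ (Fin k)) :
    EuclideanSpace ℝ R →L[ℝ] EuclideanSpace ℝ R :=
  (fderiv ℝ (m.disutilityOfTime t) (m.pathTime f ξ)).comp
    (m.net.DeltaT.comp ((fderiv ℝ (fun v => m.T v ξ) (m.net.Delta f)).comp m.net.Delta))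

lemma hasFDerivAt_disutility {t : ℝ} (ht : 0 < t) {ξ : EuclideanSpace ℝ (Fin k)}
    (hT : ContDiff ℝ 1 fun v => m.T v ξ) (f : EuclideanSpace ℝ R) :
    HasFDerivAt (fun f => m.disutility t f ξ) (m.disutilityDeriv t f ξ) f := by
  have hH := ((m.contDiff_disutilityOfTime ht).differentiable one_ne_zero
    (m.pathTime f ξ)).hasFDerivAt
  have hT' := (hT.differentiable one_ne_zero (m.net.Delta f)).hasFDerivAt
  exact hH.comp f (m.net.DeltaT.hasFDerivAt.comp f (hT'.comp f m.net.Delta.hasFDerivAt))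

section Joint

variable {Ξ : Set (EuclideanSpace ℝ (Fin k))} {F : Set (EuclideanSpace ℝ R)} {L : ℝ}

/-- Continuity in the flow together with a Lipschitz bound in `ξ` uniform in the flow gives joint
continuity. -/
lemma continuousOn_travelTime (hL : 0 < L) (hT : ∀ ξ ∈ Ξ, ContDiff ℝ 1 (fun v => m.T v ξ))
    (hlip : ∀ v ∈ m.net.Delta '' F, ∀ ξ ∈ Ξ, ∀ ξ' ∈ Ξ,
      ‖m.T v ξ - m.T v ξ'‖ ≤ L * ‖ξ - ξ'‖) :
    ContinuousOn (fun p : EuclideanSpace ℝ R × Ξ => m.T (m.net.Delta p.1) p.2)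
      (F ×ˢ univ) := by
  refine (continuousOn_prod_of_continuousOn_lipschitzOnWith'
    (fun p : EuclideanSpace ℝ A × Ξ => m.T p.1 p.2) (s := m.net.Delta '' F) (t := univ) ⟨L, hL.le⟩
    (fun v hv => LipschitzOnWith.of_dist_le_mul fun ξ _ ξ' _ => ?_)
    (fun ξ _ => (hT ξ ξ.2).continuous.continuousOn)).comp
    (f := fun p : EuclideanSpace ℝ R × Ξ => (m.net.Delta p.1, p.2)) (by fun_prop)
    fun p hp => ⟨mem_image_of_mem _ hp.1, trivial⟩
  rw [dist_eq_norm, Subtype.dist_eq, dist_eq_norm]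
  exact hlip v hv ξ ξ.2 ξ' ξ'.2

lemma continuousOn_fderiv_travelTime (hL : 0 < L)
    (hT : ∀ ξ ∈ Ξ, ContDiff ℝ 1 (fun v => m.T v ξ))
    (hlip : ∀ v ∈ m.net.Delta '' F, ∀ ξ ∈ Ξ, ∀ ξ' ∈ Ξ,
      ‖fderiv ℝ (fun v => m.T v ξ) v - fderiv ℝ (fun v => m.T v ξ') v‖ ≤ L * ‖ξ - ξ'‖) :
    ContinuousOn (fun p : EuclideanSpace ℝ R × Ξ =>
      fderiv ℝ (fun v => m.T v p.2) (m.net.Delta p.1)) (F ×ˢ univ) := by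
  refine (continuousOn_prod_of_continuousOn_lipschitzOnWith'
    (fun p : EuclideanSpace ℝ A × Ξ => fderiv ℝ (fun v => m.T v p.2) p.1)
    (s := m.net.Delta '' F) (t := univ) ⟨L, hL.le⟩
    (fun v hv => LipschitzOnWith.of_dist_le_mul fun ξ _ ξ' _ => ?_)
    (fun ξ _ => ((hT ξ ξ.2).continuous_fderiv one_ne_zero).continuousOn)).comp
    (f := fun p : EuclideanSpace ℝ R × Ξ => (m.net.Delta p.1, p.2)) (by fun_prop)
    fun p hp => ⟨mem_image_of_mem _ hp.1, trivial⟩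
  rw [dist_eq_norm, Subtype.dist_eq, dist_eq_norm]
  exact hlip v hv ξ ξ.2 ξ' ξ'.2

lemma continuousOn_pathTime (hL : 0 < L) (hT : ∀ ξ ∈ Ξ, ContDiff ℝ 1 (fun v => m.T v ξ))
    (hlip : ∀ v ∈ m.net.Delta '' F, ∀ ξ ∈ Ξ, ∀ ξ' ∈ Ξ,
      ‖m.T v ξ - m.T v ξ'‖ ≤ L * ‖ξ - ξ'‖) :
    ContinuousOn (fun p : EuclideanSpace ℝ R × Ξ => m.pathTime p.1 p.2) (F ×ˢ univ) :=
  m.net.DeltaT.continuous.comp_continuousOn (m.continuousOn_travelTime hL hT hlip)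

lemma continuousOn_disutility {t : ℝ} (ht : 0 < t) (hL : 0 < L)
    (hT : ∀ ξ ∈ Ξ, ContDiff ℝ 1 (fun v => m.T v ξ))
    (hlip : ∀ v ∈ m.net.Delta '' F, ∀ ξ ∈ Ξ, ∀ ξ' ∈ Ξ,
      ‖m.T v ξ - m.T v ξ'‖ ≤ L * ‖ξ - ξ'‖) :
    ContinuousOn (fun p : EuclideanSpace ℝ R × Ξ => m.disutility t p.1 p.2) (F ×ˢ univ) :=
  (m.contDiff_disutilityOfTime ht).continuous.comp_continuousOn
    (m.continuousOn_pathTime hL hT hlip)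

/-- The Lipschitz bound on the Jacobian enters here, through joint continuity only; its size does
not affect `κ`. -/
lemma continuousOn_disutilityDeriv {t : ℝ} (ht : 0 < t) (hL : 0 < L)
    (hT : ∀ ξ ∈ Ξ, ContDiff ℝ 1 (fun v => m.T v ξ))
    (hlip : ∀ v ∈ m.net.Delta '' F, ∀ ξ ∈ Ξ, ∀ ξ' ∈ Ξ,
      ‖m.T v ξ - m.T v ξ'‖ ≤ L * ‖ξ - ξ'‖ ∧
      ‖fderiv ℝ (fun v => m.T v ξ) v - fderiv ℝ (fun v => m.T v ξ') v‖ ≤ L * ‖ξ - ξ'‖) :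
    ContinuousOn (fun p : EuclideanSpace ℝ R × Ξ => m.disutilityDeriv t p.1 p.2)
      (F ×ˢ univ) := by
  have h1 := ((m.contDiff_disutilityOfTime ht).continuous_fderiv one_ne_zero).comp_continuousOn
    (m.continuousOn_pathTime hL hT fun v hv ξ hξ ξ' hξ' => (hlip v hv ξ hξ ξ' hξ').1)
  have h2 := m.continuousOn_fderiv_travelTime hL hT
    fun v hv ξ hξ ξ' hξ' => (hlip v hv ξ hξ ξ' hξ').2
  exact h1.clm_comp (continuousOn_const.clm_comp (h2.clm_comp continuousOn_const))

lemma norm_disutility_sub_le {t : ℝ} (ht : 0 < t) (hθ₁ : 0 ≤ m.θ₁) (hθ₂ : 0 ≤ m.θ₂)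
    (hlip : ∀ v ∈ m.net.Delta '' F, ∀ ξ ∈ Ξ, ∀ ξ' ∈ Ξ,
      ‖m.T v ξ - m.T v ξ'‖ ≤ L * ‖ξ - ξ'‖)
    {f : EuclideanSpace ℝ R} (hf : f ∈ F) (ξ ξ' : Ξ) :
    ‖m.disutility t f ξ - m.disutility t f ξ'‖
      ≤ L * ‖m.net.DeltaT‖ * (m.θ₁ + m.θ₂) * dist ξ ξ' := by
  refine (m.norm_disutilityOfTime_sub_le ht hθ₁ hθ₂ (m.pathTime f ξ) (m.pathTime f ξ')).trans ?_
  have h1 : ‖m.pathTime f ξ - m.pathTime f ξ'‖ ≤ ‖m.net.DeltaT‖ * (L * dist ξ ξ') := by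
    rw [pathTime, pathTime, ← map_sub, Subtype.dist_eq, dist_eq_norm]
    refine (m.net.DeltaT.le_opNorm _).trans ?_
    gcongr
    exact hlip _ (mem_image_of_mem _ hf) ξ ξ.2 ξ' ξ'.2
  refine (mul_le_mul_of_nonneg_left h1 (by positivity)).trans (le_of_eq (by ring))

end Joint

end Model

end Traffic

end

/-! ### Assembly and choice of constants. -/

theorem theorem3p3
    {V A W R : Type*} [Fintype A] [Fintype R] {k : ℕ}
    (m : Traffic.Model V A W R k) (hθ₁ : 0 ≤ m.θ₁) (hθ₂ : 0 ≤ m.θ₂)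
    (t : ℝ) (ht : 0 < t)
    -- the compact support
    (Ξ : Set (EuclideanSpace ℝ (Fin k))) (hΞ : IsCompact Ξ)
    -- the arc travel times are continuously differentiable in the arc flow
    (hT : ∀ ξ ∈ Ξ, ContDiff ℝ 1 (fun v => m.T v ξ))
    -- the continuous selection of strongly regular equilibria over all distributions on `Ξ`
    (f : ProbabilityMeasure Ξ → EuclideanSpace ℝ R) (hf : Continuous f)
    (hsol : ∀ Q, f Q ∈ Traffic.mlapue m t Q)
    (hreg : ∀ Q, Traffic.IsStronglyRegular (m.expDisutility t Q)
      (Traffic.normalCone m.feasible) (f Q))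
    -- the convex compact set containing a neighbourhood of these equilibria
    (F : Set (EuclideanSpace ℝ R)) (hFconv : Convex ℝ F) (hFcomp : IsCompact F)
    (hF : ∃ b > 0, ∀ Q, Metric.ball (f Q) b ⊆ F) :
    ∃ C > 0, ∀ L > 0,
      -- the arc travel times and their Jacobians are `L`-Lipschitz in `ξ`
      (∀ v ∈ m.net.Delta '' F, ∀ ξ ∈ Ξ, ∀ ξ' ∈ Ξ,
        ‖m.T v ξ - m.T v ξ'‖ ≤ L * ‖ξ - ξ'‖ ∧
        ‖fderiv ℝ (fun v => m.T v ξ) v - fderiv ℝ (fun v => m.T v ξ') v‖ ≤ L * ‖ξ - ξ'‖) →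
      -- `C` is a constant for the global Lipschitz estimate of the solution mapping
      (∀ Q₁ Q₂ : ProbabilityMeasure Ξ,
        ENNReal.ofReal ‖f Q₁ - f Q₂‖ ≤
          ENNReal.ofReal (L * C * ‖m.net.DeltaT‖ *
            (m.θ₁ + m.θ₂ + m.θ₁ * ‖m.net.Delta‖ + m.θ₂ * ‖m.net.Delta‖
              + m.θ₂ * (m.supGradPathTime F Ξ / (2 * t)))) *
          Traffic.kantorovich (Q₁ : Measure Ξ) (Q₂ : Measure Ξ)) ∧
      -- the estimators are random vectors, and their laws satisfy the same estimate
      ∀ (M : ℕ) [NeZero M],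
        Measurable (Traffic.estimator f M) ∧
        ∀ P Q : ProbabilityMeasure Ξ,
          Traffic.kantorovich (Traffic.estimatorLaw f M P) (Traffic.estimatorLaw f M Q) ≤
            ENNReal.ofReal (L * C * ‖m.net.DeltaT‖ *
              (m.θ₁ + m.θ₂ + m.θ₁ * ‖m.net.Delta‖ + m.θ₂ * ‖m.net.Delta‖
                + m.θ₂ * (m.supGradPathTime F Ξ / (2 * t)))) *
            Traffic.kantorovich (P : Measure Ξ) (Q : Measure Ξ) := by
  have : CompactSpace Ξ := isCompact_iff_compactSpace.1 hΞ
  -- The constant must precede `L`. One admissible `L₀` supplies the joint continuity from which it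
  -- is built; if none exists, the claim is vacuous.
  by_cases hex : ∃ L₀ : ℝ, 0 < L₀ ∧ ∀ v ∈ m.net.Delta '' F, ∀ ξ ∈ Ξ, ∀ ξ' ∈ Ξ,
      ‖m.T v ξ - m.T v ξ'‖ ≤ L₀ * ‖ξ - ξ'‖ ∧
      ‖fderiv ℝ (fun v => m.T v ξ) v - fderiv ℝ (fun v => m.T v ξ') v‖ ≤ L₀ * ‖ξ - ξ'‖
  swap
  · exact ⟨1, one_pos, fun L hL hlip => absurd ⟨L, hL, hlip⟩ hex⟩
  obtain ⟨L₀, hL₀, hlip₀⟩ := hex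
  have hU : interior F ×ˢ (Set.univ : Set Ξ) ⊆ F ×ˢ Set.univ :=
    Set.prod_mono_left interior_subset
  have hfU : ∀ Q, f Q ∈ interior F := by
    obtain ⟨b, hb, hball⟩ := hF
    exact fun Q => mem_interior.2 ⟨_, hball Q, Metric.isOpen_ball, Metric.mem_ball_self hb⟩
  obtain ⟨C, hC, hmain⟩ := Traffic.exists_lipschitz_of_isStronglyRegular
    (u := fun f (ξ : Ξ) => m.disutility t f ξ) (u' := fun f (ξ : Ξ) => m.disutilityDeriv t f ξ)
    isOpen_interior
    ((m.continuousOn_disutility ht hL₀ hT fun v hv ξ hξ ξ' hξ' =>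
      (hlip₀ v hv ξ hξ ξ' hξ').1).mono hU)
    (fun z _ ξ => m.hasFDerivAt_disutility ht (hT ξ ξ.2) z)
    ((m.continuousOn_disutilityDeriv ht hL₀ hT hlip₀).mono hU) hf hfU hsol hreg
  refine ⟨C, hC, fun L hL hlip => ?_⟩
  set κ : ℝ := L * ‖m.net.DeltaT‖ * (m.θ₁ + m.θ₂)
  set K : ℝ := L * C * ‖m.net.DeltaT‖ *
    (m.θ₁ + m.θ₂ + m.θ₁ * ‖m.net.Delta‖ + m.θ₂ * ‖m.net.Delta‖
      + m.θ₂ * (m.supGradPathTime F Ξ / (2 * t))) with hK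
  -- Nonnegativity suffices and holds without boundedness, as an unbounded real supremum has the
  -- default value `0`.
  have hsup : 0 ≤ m.supGradPathTime F Ξ := Real.iSup_nonneg fun _ => norm_nonneg _
  have hκ : 0 ≤ κ := by positivity
  have hκK : C * κ ≤ K := by
    have h1 : C * κ = L * C * ‖m.net.DeltaT‖ * (m.θ₁ + m.θ₂) := by ring
    rw [h1, hK, add_assoc, add_assoc]
    refine mul_le_mul_of_nonneg_left (le_add_of_nonneg_right ?_) (by positivity)
    positivity
  have hflip : ∀ P Q : ProbabilityMeasure Ξ,
      ‖f P - f Q‖ ≤ K * (Traffic.kantorovich (P : Measure Ξ) (Q : Measure Ξ)).toReal :=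
    fun P Q => (hmain κ hκ (fun z hz ξ ξ' => m.norm_disutility_sub_le ht hθ₁ hθ₂
      (fun v hv ξ hξ ξ' hξ' => (hlip v hv ξ hξ ξ' hξ').1) (interior_subset hz) ξ ξ') P Q).trans
      (mul_le_mul_of_nonneg_right hκK ENNReal.toReal_nonneg)
  have hK0 : 0 ≤ K := (mul_nonneg hC.le hκ).trans hκK
  refine ⟨fun P Q => ?_, fun M _ => ⟨(hf.comp (Traffic.continuous_empirical M)).measurable,
    Traffic.kantorovich_estimatorLaw_le hf hK0 hflip M⟩⟩
  rw [← ENNReal.ofReal_toReal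
    (Traffic.kantorovich_ne_top (P : Measure Ξ) (Q : Measure Ξ)), ← ENNReal.ofReal_mul hK0]
  exact ENNReal.ofReal_le_ofReal (hflip P Q)
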